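/- All rings are associative with identity. Let $n\ge 1$ and let $A=\sigma(R)\langle x_1,\dots,x_n\rangle$ be a skew PBW extension of a ring $R$; that is, $R$ is a subring of $A$ with the same identity, $x_1,\dots,x_n\in A$, and: (a) $A$ is a free left $R$-module with basis the standard monomials $x_1^{\alpha_1}\cdots x_n^{\alpha_n}$, $\alpha\in\mathbb N^n$; (b) for every $i$ and every $0\ne r\in R$ there is $0\neq c_{i,r}\in R$ with $x_ir-c_{i,r}x_i\in R$; (c) for all $i,j$ there is $0\ne d_{i,j}\in R$ with $x_jx_i-d_{i,j}x_ix_j\in R+Rx_1+\cdots+Rx_n$. Let $\sigma_i,\delta_i:R\to R$ be the maps (uniquely) determined by $x_ir=\sigma_i(r)x_i+\delta_i(r)$ for all $r\in R$, and for $\alpha\in\mathbb N^n$ write $\sigma^\alpha=\sigma_1^{\alpha_1}\circ\cdots\circ\sigma_n^{\alpha_n}$ and $\delta^\alpha=\delta_1^{\alpha_1}\circ\cdots\circ\delta_n^{\alpha_n}$. Suppose that $R$ is $(\Sigma,\Delta)$-compatible, i.e. for all $a,b\in R$ and $\alpha\in\mathbb N^n$ one has $a\sigma^\alpha(b)=0$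 if and only if $ab=0$, and $ab=0$ implies $a\delta^\alpha(b)=0$; that $R$ is 2-primal, i.e. the intersection of all prime (two-sided) ideals of $R$ is the set of nilpotent elements of $R$; and that $R$ has exactly two minimal prime ideals. Then \[ \operatorname{diam}(\Gamma_N(A))=2 . \] Here the nilpotent graph $\Gamma_N(A)$ has as vertices the non-zero elements $a\in A$ for which there is $0\ne b\in A$ with $ab$ nilpotent, two distinct vertices $a,b$ are adjacent if and only if $ab$ is nilpotent, and $\operatorname{diam}$ is the supremum in $\mathbb N\cup\{\infty\}$ of the distances between vertices. -/

import Mathlib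

namespace SkewPBW

/-! ### Prime ideals, prime radical and 2-primal rings (noncommutative) -/

section Primes

variable (S : Type*) [Ring S]

/-- A two-sided ideal `P` of `S` is prime if it is proper and `a S b ⊆ P` implies `a ∈ P` or
`b ∈ P`. -/
structure IsPrimeIdeal {S : Type*} [Ring S] (P : TwoSidedIdeal S) : Prop where
  ne_top : P ≠ ⊤
  mem_or_mem : ∀ a b : S, (∀ s : S, a * s * b ∈ P) → a ∈ P ∨ b ∈ P

/-- The set of minimal prime ideals of `S`. -/
def minimalPrimeIdeals : Set (TwoSidedIdeal S) :=
  {P | Minimal IsPrimeIdeal P}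

/-- The prime radical of `S`: the intersection of all prime ideals. -/
def primeRadical : TwoSidedIdeal S :=
  sInf {P | IsPrimeIdeal P}

/-- `S` is 2-primal if its prime radical is the set of all nilpotent elements. -/
def IsTwoPrimal : Prop :=
  (primeRadical S : Set S) = {a | IsNilpotent a}

end Primes

/-! ### The nilpotent graph -/

section Graph

variable (S : Type*) [Ring S]

/-- The set `Z_N(S)` of the `a ∈ S` such that `a * b` is nilpotent for some non-zero `b ∈ S`. -/
def nilZeroDivisors : Set S :=
  {a | ∃ b : S, b ≠ 0 ∧ IsNilpotent (a * b)}

theorem isNilpotent_mul_swap {S : Type*} [Ring S] {a b : S} (h : IsNilpotent (a * b)) :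
    IsNilpotent (b * a) := by
  obtain ⟨k, hk⟩ := h
  refine ⟨k + 1, ?_⟩
  rw [pow_succ, ← mul_assoc, mul_pow_mul, hk]
  simp

/-- The nilpotent graph of `S`: its vertices are the non-zero elements of `Z_N(S)`, and distinct
vertices `a`, `b` are adjacent if and only if `a * b` is nilpotent. -/
def nilpotentGraph : SimpleGraph {a : S // a ∈ nilZeroDivisors S ∧ a ≠ 0} where
  Adj a b := a ≠ b ∧ IsNilpotent (a.1 * b.1)
  symm := ⟨fun _ _ h => ⟨h.1.symm, isNilpotent_mul_swap h.2⟩⟩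
  loopless := ⟨fun _ h => h.1 rfl⟩

end Graph

/-! ### Skew PBW extensions -/

section Extension

variable {A : Type*} [Ring A] {n : ℕ}

/-- The standard monomial `x_1 ^ α_1 ⋯ x_n ^ α_n`, the factors in this order. -/
def monomial (x : Fin n → A) (α : Fin n → ℕ) : A :=
  ((List.finRange n).map fun i => x i ^ α i).prod

/-- `A` is a skew PBW extension of its subring `R` (which has the same identity) in the
elements `x_1, …, x_n`. -/
structure IsSkewPBW (R : Subring A) (x : Fin n → A) : Prop where
  /-- The standard monomials are left linearly independent over `R`. -/
  linearIndependent : LinearIndependent R (monomial x)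
  /-- The standard monomials generate `A` as a left `R`-module. -/
  span_eq_top : Submodule.span R (Set.range (monomial x)) = ⊤
  exists_coeff : ∀ (i : Fin n) (r : R), r ≠ 0 → ∃ c : R, c ≠ 0 ∧ x i * r - c * x i ∈ R
  exists_comm : ∀ i j : Fin n, ∃ d : R, d ≠ 0 ∧ ∃ (r₀ : R) (r : Fin n → R),
    x j * x i - d * (x i * x j) = r₀ + ∑ k, (r k : A) * x k

theorem monomial_zero (x : Fin n → A) : monomial x 0 = 1 := by
  simp [monomial]

theorem monomial_single (x : Fin n → A) (i : Fin n) : monomial x (Pi.single i 1) = x i := by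
  unfold monomial
  rw [List.prod_map_eq_pow_single i]
  · simp [List.count_eq_one_of_mem (List.nodup_finRange n) (List.mem_finRange i)]
  · intro j hj _
    simp [hj]

namespace IsSkewPBW

variable {R : Subring A} {x : Fin n → A}

/-- The standard monomials as a basis of the left `R`-module `A`. -/
noncomputable def basis (h : IsSkewPBW R x) : Module.Basis (Fin n → ℕ) R A :=
  Module.Basis.mk h.linearIndependent h.span_eq_top.ge

/-- `σ_i r` is the coefficient of `x_i` in `x_i * r`. -/
noncomputable def sigma (h : IsSkewPBW R x) (i : Fin n) (r : R) : R :=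
  h.basis.repr (x i * r) (Pi.single i 1)

/-- `δ_i r` is the constant coefficient of `x_i * r`. -/
noncomputable def delta (h : IsSkewPBW R x) (i : Fin n) (r : R) : R :=
  h.basis.repr (x i * r) 0

theorem eq_sigma_and_eq_delta (h : IsSkewPBW R x) (i : Fin n) (r a b : R)
    (hr : x i * r = a * x i + b) : a = h.sigma i r ∧ b = h.delta i r := by
  have e : x i * r = a • h.basis (Pi.single i 1) + b • h.basis 0 := by
    simp [basis, monomial_zero, monomial_single, Subring.smul_def, hr]
  have hne : (Pi.single i 1 : Fin n → ℕ) ≠ 0 := by simp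
  constructor
  · simp [sigma, e]
  · simp [delta, e, hne]

/-- The relation that characterizes the pair `σ_i`, `δ_i`. -/
theorem mul_eq (h : IsSkewPBW R x) (i : Fin n) (r : R) :
    x i * r = h.sigma i r * x i + h.delta i r := by
  by_cases h0 : r = 0
  · simp [sigma, delta, h0]
  · obtain ⟨c, -, hc⟩ := h.exists_coeff i r h0
    have e : x i * r = c * x i + (⟨_, hc⟩ : R) := by simp
    obtain ⟨h1, h2⟩ := h.eq_sigma_and_eq_delta i r _ _ e
    rw [← h1, ← h2]
    exact e

end IsSkewPBW

/-! ### Compatibility -/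

/-- The composition `f_1 ^ α_1 ∘ ⋯ ∘ f_n ^ α_n` of iterates of the maps `f_i`. -/
def iterComp {S : Type*} (f : Fin n → S → S) (α : Fin n → ℕ) : S → S :=
  ((List.finRange n).map fun i => (f i)^[α i]).foldr (fun g k => g ∘ k) id

/-- `S` is `(Σ, Δ)`-compatible for the families `Σ = (σ_i)` and `Δ = (δ_i)` of self-maps. -/
structure IsCompatible {S : Type*} [Ring S] (σ δ : Fin n → S → S) : Prop where
  sigma_iff : ∀ (a b : S) (α : Fin n → ℕ), a * iterComp σ α b = 0 ↔ a * b = 0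
  delta_of : ∀ (a b : S) (β : Fin n → ℕ), a * b = 0 → a * iterComp δ β b = 0

end Extension

end SkewPBW

/-! The two minimal primes of `R` extend to incomparable completely prime ideals of `A` whose
intersection is the set of nilpotent elements of `A`; a ring of that kind has a small nilpotent
graph.

Let P, Q be the minimal primes of `R`. As `R` is 2-primal, they are completely prime
(`isCompletelyPrime_of_minimal`) and P ∩ Q consists of the nilpotent elements, so P = {a : every
element of Qa is nilpotent}. By compatibility, σ_i and δ_i may be inserted at any factor of a
vanishing product, and σ_i removed (`eq_zero_of_subst`); so P and Q are stable under these maps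
(`isStablePrime_of_minimal`). Modulo a stable P leading exponents add, hence the elements with all
coefficients in P form a completely prime ideal of `A` (`isCompletelyPrime_extend`). Nilpotent
elements of `R` lie in every prime ideal of `A` (`coe_mem_of_isNilpotent`), so an element with
nilpotent coefficients is nilpotent; this covers the intersection of the two extensions.

For the upper bound, a non-zero element of the intersection is joined to everything; if there is
none, each vertex lies in one of the two ideals and multiplies into the nilpotents with the other
one. For the lower bound take p ∈ P \ Q: p and p x_1 lie in the extension of P, but their product
avoids that of Q. -/

namespace SkewPBW

/-! ### Existence of prime ideals -/

section PrimeExistence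

variable {S : Type*} [Ring S]

/-- The two-sided ideal of the `t` with `a S t ⊆ P`. -/
def rightColon (P : TwoSidedIdeal S) (a : S) : TwoSidedIdeal S :=
  TwoSidedIdeal.mk' {t | ∀ r, a * r * t ∈ P}
    (fun r => by simp)
    (fun {x y} hx hy r => by simpa [mul_add] using P.add_mem (hx r) (hy r))
    (fun {x} hx r => by simpa using P.neg_mem (hx r))
    (fun {x y} hy r => by simpa [mul_assoc] using hy (r * x))
    (fun {x y} hx r => by simpa [mul_assoc] using P.mul_mem_right _ y (hx r))

/-- The two-sided ideal of the `s` with `s S b ⊆ P`. -/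
def leftColon (P : TwoSidedIdeal S) (b : S) : TwoSidedIdeal S :=
  TwoSidedIdeal.mk' {s | ∀ r, s * r * b ∈ P}
    (fun r => by simp)
    (fun {x y} hx hy r => by simpa [add_mul] using P.add_mem (hx r) (hy r))
    (fun {x} hx r => by simpa using P.neg_mem (hx r))
    (fun {x y} hy r => by simpa [mul_assoc] using P.mul_mem_left x _ (hy r))
    (fun {x y} hx r => by simpa [mul_assoc] using hx (y * r))

theorem mem_rightColon {P : TwoSidedIdeal S} {a t : S} :
    t ∈ rightColon P a ↔ ∀ r, a * r * t ∈ P := by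
  simp [rightColon, TwoSidedIdeal.mem_mk']

theorem mem_leftColon {P : TwoSidedIdeal S} {b s : S} :
    s ∈ leftColon P b ↔ ∀ r, s * r * b ∈ P := by
  simp [leftColon, TwoSidedIdeal.mem_mk']

/-- The union of a non-empty chain of two-sided ideals. -/
def chainUnion (c : Set (TwoSidedIdeal S)) (hc : IsChain (· ≤ ·) c) (hne : c.Nonempty) :
    TwoSidedIdeal S :=
  TwoSidedIdeal.mk' {t | ∃ I ∈ c, t ∈ I}
    (hne.imp fun I hI => ⟨hI, I.zero_mem⟩)
    (fun {x y} hx hy => by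
      obtain ⟨I, hI, hx⟩ := hx
      obtain ⟨J, hJ, hy⟩ := hy
      obtain h | h := hc.total hI hJ
      · exact ⟨J, hJ, J.add_mem (h hx) hy⟩
      · exact ⟨I, hI, I.add_mem hx (h hy)⟩)
    (fun {x} ⟨I, hI, hx⟩ => ⟨I, hI, I.neg_mem hx⟩)
    (fun {x y} ⟨I, hI, hy⟩ => ⟨I, hI, I.mul_mem_left x y hy⟩)
    (fun {x y} ⟨I, hI, hx⟩ => ⟨I, hI, I.mul_mem_right x y hx⟩)

theorem mem_chainUnion {c : Set (TwoSidedIdeal S)} {hc : IsChain (· ≤ ·) c} {hne : c.Nonempty}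
    {t : S} : t ∈ chainUnion c hc hne ↔ ∃ I ∈ c, t ∈ I := by
  simp [chainUnion, TwoSidedIdeal.mem_mk']

/-- A non-empty m-system that avoids `0` is disjoint from some prime ideal. -/
theorem exists_isPrimeIdeal_disjoint (M : Set S) (hne : M.Nonempty) (h0 : (0 : S) ∉ M)
    (hM : ∀ s ∈ M, ∀ t ∈ M, ∃ r, s * r * t ∈ M) :
    ∃ P : TwoSidedIdeal S, IsPrimeIdeal P ∧ ∀ s ∈ M, s ∉ P := by
  obtain ⟨P, -, hP⟩ := zorn_le_nonempty₀ {I : TwoSidedIdeal S | ∀ s ∈ M, s ∉ I}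
    (fun c hcs hc y hy => ⟨chainUnion c hc ⟨y, hy⟩,
      fun s hs h => by
        obtain ⟨I, hI, hsI⟩ := mem_chainUnion.1 h
        exact hcs hI s hs hsI,
      fun I hI t ht => mem_chainUnion.2 ⟨I, hI, ht⟩⟩) ⊥
    (fun s hs h => h0 ((TwoSidedIdeal.mem_bot S).1 h ▸ hs))
  have key : ∀ J : TwoSidedIdeal S, P ≤ J → ∀ b ∈ J, b ∉ P → ∃ s ∈ M, s ∈ J := by
    intro J hPJ b hbJ hbP
    by_contra! hJ
    exact hbP (hP.2 hJ hPJ hbJ)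
  refine ⟨P, ⟨?_, ?_⟩, hP.1⟩
  · rintro rfl
    obtain ⟨s, hs⟩ := hne
    exact hP.1 s hs trivial
  · intro a b hab
    by_contra! h
    -- The factors are enlarged one at a time: b is traded for some t ∈ M with a S t ⊆ P, then a for
    -- some s ∈ M with s S t ⊆ P, against the m-system property.
    obtain ⟨t, htM, ht⟩ := key (rightColon P a)
      (fun t ht => mem_rightColon.2 fun r => P.mul_mem_left _ _ ht) b (mem_rightColon.2 hab) h.2
    obtain ⟨s, hsM, hs⟩ := key (leftColon P t)
      (fun s hs => mem_leftColon.2 fun r => P.mul_mem_right _ _ (P.mul_mem_right _ _ hs)) a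
      (mem_leftColon.2 (mem_rightColon.1 ht)) h.1
    obtain ⟨r, hr⟩ := hM s hsM t htM
    exact hP.1 _ hr (mem_leftColon.1 hs r)

/-- An element that lies in all prime ideals is nilpotent. -/
theorem isNilpotent_of_forall_mem_prime {a : S}
    (ha : ∀ P : TwoSidedIdeal S, IsPrimeIdeal P → a ∈ P) : IsNilpotent a := by
  by_contra hn
  obtain ⟨P, hP, hdisj⟩ := exists_isPrimeIdeal_disjoint (Set.range fun k : ℕ => a ^ k)
    ⟨_, 0, rfl⟩ (fun ⟨k, hk⟩ => hn ⟨k, hk⟩)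
    (by
      rintro _ ⟨k, rfl⟩ _ ⟨l, rfl⟩
      exact ⟨1, k + l, by simp [pow_add]⟩)
  exact hdisj a ⟨1, pow_one a⟩ (ha P hP)

/-- If a set `M` of non-zero elements contains with each `a` some `a r a`, then `M` misses the
intersection of the prime ideals. -/
theorem exists_isPrimeIdeal_notMem (M : Set S) (h0 : (0 : S) ∉ M)
    (hM : ∀ a ∈ M, ∃ r, a * r * a ∈ M) {a : S} (ha : a ∈ M) :
    ∃ P : TwoSidedIdeal S, IsPrimeIdeal P ∧ a ∉ P := by
  choose! f hf using hM
  -- Each term is both a left and a right multiple of all earlier ones, so u (k + l + 1) has the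
  -- form u k * r * u l and the range is an m-system.
  let u : ℕ → S := fun k => Nat.rec a (fun _ b => b * f b * b) k
  have hu : ∀ k, u (k + 1) = u k * f (u k) * u k := fun k => rfl
  have huM : ∀ k, u k ∈ M := by
    intro k
    induction k with
    | zero => exact ha
    | succ k ih => exact hf _ ih
  have hright : ∀ k l, ∃ r, u (k + l) = r * u k := by
    intro k l
    induction l with
    | zero => exact ⟨1, by simp⟩
    | succ l ih =>
      obtain ⟨r, hr⟩ := ih
      refine ⟨u (k + l) * f (u (k + l)) * r, ?_⟩
      rw [mul_assoc, ← hr]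
      exact hu _
  have hleft : ∀ k l, ∃ r, u (k + l) = u k * r := by
    intro k l
    induction l with
    | zero => exact ⟨1, by simp⟩
    | succ l ih =>
      obtain ⟨r, hr⟩ := ih
      refine ⟨r * (f (u (k + l)) * u (k + l)), ?_⟩
      rw [← mul_assoc, ← hr, ← mul_assoc]
      exact hu _
  obtain ⟨P, hP, hdisj⟩ := exists_isPrimeIdeal_disjoint (Set.range u) ⟨_, 0, rfl⟩
    (by
      rintro ⟨k, hk⟩
      exact h0 (hk ▸ huM k))
    (by
      rintro _ ⟨k, rfl⟩ _ ⟨l, rfl⟩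
      obtain ⟨r, hr⟩ := hleft k l
      obtain ⟨s, hs⟩ := hright l k
      refine ⟨r * f (u (k + l)) * s, k + l + 1, ?_⟩
      rw [add_comm l k] at hs
      calc u (k + l + 1) = u (k + l) * f (u (k + l)) * u (k + l) := hu _
        _ = u k * r * f (u (k + l)) * (s * u l) := by rw [← hr, ← hs]
        _ = _ := by simp only [mul_assoc])
  exact ⟨P, hP, hdisj a ⟨0, rfl⟩⟩

/-- Every prime ideal contains a minimal prime ideal. -/
theorem exists_minimalPrimeIdeal_le {P : TwoSidedIdeal S} (hP : IsPrimeIdeal P) :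
    ∃ Q ∈ minimalPrimeIdeals S, Q ≤ P := by
  -- In the reversed order a chain is bounded by its intersection, which is prime: if I omits a and
  -- J omits b, the smaller of the two omits both.
  obtain ⟨Q, hQP, hQ⟩ := zorn_le_nonempty₀ (α := (TwoSidedIdeal S)ᵒᵈ)
    {I | IsPrimeIdeal (OrderDual.ofDual I)}
    (fun c hcs hc y hy => by
      refine ⟨OrderDual.toDual (sInf (OrderDual.toDual ⁻¹' c)), ⟨?_, ?_⟩, ?_⟩
      · intro htop
        refine (hcs hy).ne_top (top_le_iff.1 ?_)
        rw [← htop]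
        exact sInf_le hy
      · intro a b hab
        simp only [OrderDual.ofDual_toDual, TwoSidedIdeal.mem_sInf] at hab ⊢
        by_contra! h
        obtain ⟨⟨I, hI, ha⟩, J, hJ, hb⟩ := h
        have hI' : IsPrimeIdeal I := hcs hI
        have hJ' : IsPrimeIdeal J := hcs hJ
        obtain h | h := hc.total hI hJ
        · obtain h1 | h1 := hJ'.mem_or_mem a b fun s => hab s _ hJ
          · exact ha ((show J ≤ I from h) h1)
          · exact hb h1
        · obtain h1 | h1 := hI'.mem_or_mem a b fun s => hab s _ hI
          · exact ha h1
          · exact hb ((show I ≤ J from h) h1)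
      · intro z hz
        exact sInf_le (α := TwoSidedIdeal S) hz)
    (OrderDual.toDual P) hP
  exact ⟨OrderDual.ofDual Q, ⟨hQ.1, fun I hI h => hQ.2 (y := OrderDual.toDual I) hI h⟩, hQP⟩

end PrimeExistence

/-! ### Completely prime ideals and 2-primal rings -/

section TwoPrimal

variable {S : Type*} [Ring S]

/-- A two-sided ideal is completely prime if it is proper and its complement is closed under
multiplication. -/
structure IsCompletelyPrime (P : TwoSidedIdeal S) : Prop where
  one_notMem : (1 : S) ∉ P
  mem_or_mem : ∀ a b : S, a * b ∈ P → a ∈ P ∨ b ∈ P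

theorem IsCompletelyPrime.mul_notMem {P : TwoSidedIdeal S} (hP : IsCompletelyPrime P) {a b : S}
    (ha : a ∉ P) (hb : b ∉ P) : a * b ∉ P :=
  fun h => (hP.mem_or_mem a b h).elim ha hb

theorem IsCompletelyPrime.mem_of_isNilpotent {P : TwoSidedIdeal S} (hP : IsCompletelyPrime P)
    {a : S} (ha : IsNilpotent a) : a ∈ P := by
  obtain ⟨k, hk⟩ := ha
  by_contra h
  have : ∀ m, a ^ m ∉ P := by
    intro m
    induction m with
    | zero => simpa using hP.one_notMem
    | succ m ih => exact pow_succ a m ▸ hP.mul_notMem ih h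
  exact this k (hk ▸ P.zero_mem)

theorem IsTwoPrimal.mem_primeRadical_iff (h : IsTwoPrimal S) {a : S} :
    a ∈ primeRadical S ↔ IsNilpotent a := by
  have := Set.ext_iff.1 h a
  simpa using this

theorem IsTwoPrimal.isNilpotent_mul_left (h : IsTwoPrimal S) (a : S) {b : S}
    (hb : IsNilpotent b) : IsNilpotent (a * b) :=
  h.mem_primeRadical_iff.1 ((primeRadical S).mul_mem_left _ _ (h.mem_primeRadical_iff.2 hb))

theorem IsTwoPrimal.isNilpotent_mul_right (h : IsTwoPrimal S) {a : S} (b : S)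
    (ha : IsNilpotent a) : IsNilpotent (a * b) :=
  h.mem_primeRadical_iff.1 ((primeRadical S).mul_mem_right _ _ (h.mem_primeRadical_iff.2 ha))

/-- The square of a r b contains the factor b a, which is nilpotent and hence lies in the ideal of
nilpotent elements. -/
theorem IsTwoPrimal.isNilpotent_mul_mul (h : IsTwoPrimal S) {a b : S}
    (hab : IsNilpotent (a * b)) (r : S) : IsNilpotent (a * r * b) := by
  have h2 : IsNilpotent ((a * r * b) ^ 2) := by
    have := h.isNilpotent_mul_right (r * b)
      (h.isNilpotent_mul_left (a * r) (isNilpotent_mul_swap hab))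
    simpa [pow_two, mul_assoc] using this
  exact (IsNilpotent.pow_iff_pos two_ne_zero).1 h2

theorem IsPrimeIdeal.mem_of_isNilpotent (h : IsTwoPrimal S) {P : TwoSidedIdeal S}
    (hP : IsPrimeIdeal P) {a : S} (ha : IsNilpotent a) : a ∈ P :=
  (TwoSidedIdeal.mem_sInf S).1 (h.mem_primeRadical_iff.2 ha) P hP

/-- In a 2-primal ring the minimal prime ideals are completely prime. -/
theorem isCompletelyPrime_of_minimal (h : IsTwoPrimal S) {P : TwoSidedIdeal S}
    (hP : P ∈ minimalPrimeIdeals S) : IsCompletelyPrime P := by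
  have hPp : IsPrimeIdeal P := hP.1
  have h1P : (1 : S) ∉ P := fun h1 => hPp.ne_top (P.one_mem_iff.1 h1)
  let M := Submonoid.closure {a : S | a ∉ P}
  -- A product s of elements outside P is replaced by a single p ∉ P, obtained by inserting elements
  -- between the factors. Were s = 0, then p itself would be nilpotent and so in P; hence 0 ∉ M.
  have hM : ∀ s ∈ M, ∃ p ∉ P, ∀ y, IsNilpotent (s * y) → IsNilpotent (p * y) := by
    intro s hs
    induction hs using Submonoid.closure_induction with
    | mem s hs => exact ⟨s, hs, fun y hy => hy⟩
    | one => exact ⟨1, h1P, fun y hy => hy⟩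
    | mul s t _ _ ihs iht =>
      obtain ⟨p, hp, hps⟩ := ihs
      obtain ⟨q, hq, hqt⟩ := iht
      have : ∃ r, p * r * q ∉ P := by
        by_contra! hr
        exact (hPp.mem_or_mem p q hr).elim hp hq
      obtain ⟨r, hr⟩ := this
      refine ⟨p * r * q, hr, fun y hy => ?_⟩
      have h1 : IsNilpotent (p * (t * y)) := hps _ (by simpa [mul_assoc] using hy)
      have h2 : IsNilpotent (q * (y * p)) :=
        hqt _ (by simpa [mul_assoc] using isNilpotent_mul_swap h1)
      have h3 : IsNilpotent (p * (q * y)) :=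
        isNilpotent_mul_swap (by simpa [mul_assoc] using h2)
      simpa [mul_assoc] using h.isNilpotent_mul_mul h3 r
  obtain ⟨Q, hQ, hdisj⟩ := exists_isPrimeIdeal_disjoint (M : Set S) ⟨1, M.one_mem⟩
    (fun h0 => by
      obtain ⟨p, hp, hp0⟩ := hM 0 h0
      exact hp (hPp.mem_of_isNilpotent h (by simpa using hp0 1 (by simp))))
    (fun s hs t ht => ⟨1, by simpa using M.mul_mem hs ht⟩)
  -- Q avoids the complement of P, so minimality forces Q = P; as Q also avoids all products in M, P
  -- is completely prime.
  have hQP : Q ≤ P := fun a ha => by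
    by_contra haP
    exact hdisj a (Submonoid.subset_closure haP) ha
  have hPQ : P ≤ Q := hP.2 hQ hQP
  refine ⟨h1P, fun a b hab => ?_⟩
  by_contra! hab'
  exact hdisj _ (M.mul_mem (Submonoid.subset_closure hab'.1) (Submonoid.subset_closure hab'.2))
    (hPQ hab)

end TwoPrimal

end SkewPBW

namespace SkewPBW

namespace IsSkewPBW

variable {A : Type*} [Ring A] {n : ℕ} {R : Subring A} {x : Fin n → A}

/-! ### The maps `σ_i` and `δ_i` -/

section Maps

variable (h : IsSkewPBW R x)

theorem basis_apply (α : Fin n → ℕ) : h.basis α = monomial x α := by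
  simp [basis]

theorem sigma_mul (i : Fin n) (a b : R) : h.sigma i (a * b) = h.sigma i a * h.sigma i b :=
  ((h.eq_sigma_and_eq_delta i (a * b) (h.sigma i a * h.sigma i b)
    (h.sigma i a * h.delta i b + h.delta i a * b) (by
      push_cast
      rw [← mul_assoc, h.mul_eq i a, add_mul, mul_assoc _ (x i), h.mul_eq i b]
      noncomm_ring)).1).symm

theorem delta_mul (i : Fin n) (a b : R) :
    h.delta i (a * b) = h.sigma i a * h.delta i b + h.delta i a * b :=
  ((h.eq_sigma_and_eq_delta i (a * b) (h.sigma i a * h.sigma i b)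
    (h.sigma i a * h.delta i b + h.delta i a * b) (by
      push_cast
      rw [← mul_assoc, h.mul_eq i a, add_mul, mul_assoc _ (x i), h.mul_eq i b]
      noncomm_ring)).2).symm

end Maps

end IsSkewPBW

/-! ### Substitutions that preserve vanishing products -/

section Subst

variable {n : ℕ} {S : Type*} [Ring S]

theorem foldr_comp_single {S : Type*} (f : Fin n → S → S) (i : Fin n) (l : List (Fin n))
    (hl : l.Nodup) :
    (l.map fun j => (f j)^[(Pi.single i 1 : Fin n → ℕ) j]).foldr (fun g k => g ∘ k) id =
      if i ∈ l then f i else id := by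
  induction l with
  | nil => simp
  | cons j t ih =>
    obtain ⟨hj, ht⟩ := List.nodup_cons.1 hl
    rw [List.map_cons, List.foldr_cons, ih ht]
    by_cases hij : j = i
    · subst hij
      simp [hj]
    · simp [hij, Ne.symm hij]

theorem iterComp_single {S : Type*} (f : Fin n → S → S) (i : Fin n) :
    iterComp f (Pi.single i 1) = f i := by
  rw [iterComp, foldr_comp_single f i _ (List.nodup_finRange n)]
  simp

theorem IsCompatible.mul_sigma_eq_zero_iff {σ δ : Fin n → S → S} (hc : IsCompatible σ δ)
    (a b : S) (i : Fin n) : a * σ i b = 0 ↔ a * b = 0 := by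
  simpa [iterComp_single] using hc.sigma_iff a b (Pi.single i 1)

theorem IsCompatible.mul_delta_eq_zero {σ δ : Fin n → S → S} (hc : IsCompatible σ δ)
    {a b : S} (i : Fin n) (hab : a * b = 0) : a * δ i b = 0 := by
  simpa [iterComp_single] using hc.delta_of a b (Pi.single i 1) hab

/-- One substitution `u b v ↦ u σ_i(b) v`, `u b v ↦ u δ_i(b) v` or `u σ_i(b) v ↦ u b v`. -/
inductive SubstStep (σ δ : Fin n → S → S) : S → S → Prop
  | sigma (u b v : S) (i : Fin n) : SubstStep σ δ (u * b * v) (u * σ i b * v)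
  | delta (u b v : S) (i : Fin n) : SubstStep σ δ (u * b * v) (u * δ i b * v)
  | sigma_symm (u b v : S) (i : Fin n) : SubstStep σ δ (u * σ i b * v) (u * b * v)

/-- The reflexive transitive closure of `SubstStep`. -/
def Subst (σ δ : Fin n → S → S) : S → S → Prop :=
  Relation.ReflTransGen (SubstStep σ δ)

variable {σ δ : Fin n → S → S}

theorem SubstStep.mul_mul {c d : S} (h : SubstStep σ δ c d) (y z : S) :
    SubstStep σ δ (y * c * z) (y * d * z) := by
  cases h with
  | sigma u b v i => simpa only [mul_assoc] using SubstStep.sigma (δ := δ) (y * u) b (v * z) i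
  | delta u b v i => simpa only [mul_assoc] using SubstStep.delta (σ := σ) (y * u) b (v * z) i
  | sigma_symm u b v i =>
    simpa only [mul_assoc] using SubstStep.sigma_symm (δ := δ) (y * u) b (v * z) i

theorem Subst.mul_mul {c d : S} (h : Subst σ δ c d) (y z : S) :
    Subst σ δ (y * c * z) (y * d * z) :=
  Relation.ReflTransGen.lift (fun w => y * w * z)
    (fun a b (hab : SubstStep σ δ a b) => hab.mul_mul y z) _ _ h

theorem Subst.mul {a b c d : S} (h : Subst σ δ a b) (h' : Subst σ δ c d) :
    Subst σ δ (a * c) (b * d) := by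
  have h1 := h.mul_mul 1 c
  have h2 := h'.mul_mul b 1
  simp only [one_mul, mul_one] at h1 h2
  exact Relation.ReflTransGen.trans h1 h2

theorem Subst.pow {a b : S} (h : Subst σ δ a b) (k : ℕ) : Subst σ δ (a ^ k) (b ^ k) := by
  induction k with
  | zero => simpa using! Relation.ReflTransGen.refl
  | succ k ih => simpa only [pow_succ] using ih.mul h

theorem Subst.mul_sigma (a b : S) (i : Fin n) : Subst σ δ (a * b) (a * σ i b) := by
  simpa using! Relation.ReflTransGen.single (SubstStep.sigma (σ := σ) (δ := δ) a b 1 i)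

theorem Subst.mul_delta (a b : S) (i : Fin n) : Subst σ δ (a * b) (a * δ i b) := by
  simpa using! Relation.ReflTransGen.single (SubstStep.delta (σ := σ) (δ := δ) a b 1 i)

theorem Subst.sigma_mul (a b : S) (i : Fin n) : Subst σ δ (a * σ i b) (a * b) := by
  simpa using! Relation.ReflTransGen.single (SubstStep.sigma_symm (σ := σ) (δ := δ) a b 1 i)

end Subst

/-! ### Substitutions in the coefficient ring and nilpotent elements of the extension -/

namespace IsSkewPBW

variable {A : Type*} [Ring A] {n : ℕ} {R : Subring A} {x : Fin n → A} (h : IsSkewPBW R x)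

/-- Compatibility acts only on the last factor; applying σ_i to v as well and using σ_i(b) σ_i(v) =
σ_i(b v) reaches the middle one. -/
theorem mul_sigma_mul_eq_zero_iff (hc : IsCompatible h.sigma h.delta)
    (u b v : R) (i : Fin n) :
    u * h.sigma i b * v = 0 ↔ u * b * v = 0 := by
  rw [← hc.mul_sigma_eq_zero_iff _ v i, mul_assoc, ← h.sigma_mul,
    hc.mul_sigma_eq_zero_iff, mul_assoc]

/-- In u δ_i(b v) = u σ_i(b) δ_i(v) + u δ_i(b) v the left side and the first summand vanish. -/
theorem mul_delta_mul_eq_zero (hc : IsCompatible h.sigma h.delta)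
    {u b v : R} (i : Fin n) (h0 : u * b * v = 0) :
    u * h.delta i b * v = 0 := by
  have h1 : u * h.delta i (b * v) = 0 := hc.mul_delta_eq_zero i (by rwa [← mul_assoc])
  have h2 : u * h.sigma i b * h.delta i v = 0 :=
    hc.mul_delta_eq_zero i ((h.mul_sigma_mul_eq_zero_iff hc u b v i).2 h0)
  rwa [h.delta_mul, mul_add, ← mul_assoc, h2, zero_add, ← mul_assoc] at h1

theorem eq_zero_of_subst (hc : IsCompatible h.sigma h.delta)
    {c d : R} (hcd : Subst h.sigma h.delta c d) (h0 : c = 0) : d = 0 := by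
  induction hcd with
  | refl => exact h0
  | tail _ hs ih =>
    cases hs with
    | sigma u b v i => exact (h.mul_sigma_mul_eq_zero_iff hc u b v i).2 ih
    | delta u b v i => exact h.mul_delta_mul_eq_zero hc i ih
    | sigma_symm u b v i => exact (h.mul_sigma_mul_eq_zero_iff hc u b v i).1 ih

theorem isNilpotent_of_subst (hc : IsCompatible h.sigma h.delta)
    {c d : R} (hcd : Subst h.sigma h.delta c d) (h0 : IsNilpotent c) :
    IsNilpotent d := by
  obtain ⟨k, hk⟩ := h0
  exact ⟨k, h.eq_zero_of_subst hc (hcd.pow k) hk⟩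

/-- Moving y leftwards past the variables by x_i y = σ_i(y) x_i + δ_i(y) produces only substitutes
of y next to u. The claim is inductive only for all such y at once, hence the quantifier in `T`. -/
theorem mul_monomial_mul_mem (I : TwoSidedIdeal A) (u : A) (y : R)
    (hy : ∀ z : R, Subst h.sigma h.delta y z → u * z ∈ I) (α : Fin n → ℕ) :
    u * monomial x α * y ∈ I := by
  let T : Set A := {w | ∀ y : R, (∀ z : R, Subst h.sigma h.delta y z → u * z ∈ I) →
    u * w * y ∈ I}
  have hx : ∀ w ∈ T, ∀ i, w * x i ∈ T := by
    intro w hw i y hy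
    have h1 : u * w * h.sigma i y ∈ I := hw _ fun z hz => hy z
      (Relation.ReflTransGen.trans (by simpa using! Subst.mul_sigma 1 y i) hz)
    have h2 : u * w * h.delta i y ∈ I := hw _ fun z hz => hy z
      (Relation.ReflTransGen.trans (by simpa using! Subst.mul_delta 1 y i) hz)
    have e : u * (w * x i) * y = u * w * h.sigma i y * x i + u * w * h.delta i y := by
      rw [← mul_assoc, mul_assoc (u * w), h.mul_eq i y]
      noncomm_ring
    rw [e]
    exact I.add_mem (I.mul_mem_right _ _ h1) h2
  have hpow : ∀ w ∈ T, ∀ i k, w * x i ^ k ∈ T := by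
    intro w hw i k
    induction k with
    | zero => simpa using hw
    | succ k ih => simpa only [pow_succ, mul_assoc] using hx _ ih i
  have hl : ∀ (l : List (Fin n)), ∀ w ∈ T, w * (l.map fun i => x i ^ α i).prod ∈ T := by
    intro l
    induction l with
    | nil => intro w hw; simpa using hw
    | cons i l ih =>
      intro w hw
      simpa only [List.map_cons, List.prod_cons, mul_assoc] using ih _ (hpow w hw i (α i))
  have h1 : (1 : A) ∈ T := fun y hy => by simpa using hy y Relation.ReflTransGen.refl
  have := hl (List.finRange n) 1 h1
  rw [one_mul] at this
  exact this y hy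

/-- The nilpotent elements of a 2-primal compatible coefficient ring lie in every prime ideal of
the extension. -/
theorem coe_mem_of_isNilpotent (hc : IsCompatible h.sigma h.delta)
    (htp : IsTwoPrimal R) {Q : TwoSidedIdeal A} (hQ : IsPrimeIdeal Q)
    {a : R} (ha : IsNilpotent a) : (a : A) ∈ Q := by
  by_contra haQ
  -- If c ∈ M had no c r c in M, every d r z with z a substitute of d would lie in Q, so d A d ⊆ Q
  -- and d ∈ Q. Thus `exists_isPrimeIdeal_notMem` gives a prime of `R` omitting a nilpotent element.
  let M : Set R := {c | ∃ d : R, Subst h.sigma h.delta c d ∧ (d : A) ∉ Q}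
  have hM0 : (0 : R) ∉ M := by
    rintro ⟨d, hd, hdQ⟩
    exact hdQ (by simp [h.eq_zero_of_subst hc hd rfl])
  have hM : ∀ c ∈ M, ∃ r, c * r * c ∈ M := by
    rintro c ⟨d, hcd, hdQ⟩
    by_contra! hr
    simp only [M, Set.mem_ofPred_eq, not_exists, not_and, not_not] at hr
    -- The free factor r absorbs the left coefficients of f.
    have key : ∀ f : A, ∀ r : R, (d : A) * (r * f) * d ∈ Q := by
      intro f
      have hf : f ∈ Submodule.span R (Set.range (monomial x)) := by
        rw [h.span_eq_top]; trivial
      induction hf using Submodule.span_induction with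
      | mem f hf =>
        obtain ⟨α, rfl⟩ := hf
        intro r
        have := h.mul_monomial_mul_mem Q (d * r : A) d (fun z hz => ?_) α
        · simpa only [mul_assoc] using this
        · exact_mod_cast hr r _ ((hcd.mul Relation.ReflTransGen.refl).mul
            (Relation.ReflTransGen.trans hcd hz))
      | zero => intro r; simp
      | add f g _ _ hf hg =>
        intro r
        have := Q.add_mem (hf r) (hg r)
        simpa only [mul_add, add_mul] using this
      | smul s f _ hf =>
        intro r
        have := hf (r * s)
        simpa only [Subring.smul_def, smul_eq_mul, Subring.coe_mul, mul_assoc] using this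
    have hd := hQ.mem_or_mem (d : A) d fun s => by simpa using key s 1
    exact hdQ (hd.elim id id)
  obtain ⟨P, hP, haP⟩ := exists_isPrimeIdeal_notMem M hM0 hM ⟨a, Relation.ReflTransGen.refl, haQ⟩
  exact haP (hP.mem_of_isNilpotent htp ha)

/-- An element whose coefficients are nilpotent is nilpotent. -/
theorem isNilpotent_of_coeff (hc : IsCompatible h.sigma h.delta)
    (htp : IsTwoPrimal R) {f : A}
    (hf : ∀ α, IsNilpotent (h.basis.repr f α)) : IsNilpotent f := by
  refine isNilpotent_of_forall_mem_prime fun Q hQ => ?_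
  rw [← h.basis.linearCombination_repr f, Finsupp.linearCombination_apply, Finsupp.sum]
  refine sum_mem fun α _ => ?_
  rw [Subring.smul_def]
  exact Q.mul_mem_right _ _ (h.coe_mem_of_isNilpotent hc htp hQ (hf α))

end IsSkewPBW

end SkewPBW

namespace SkewPBW

/-! ### Multiplying a variable and a monomial -/

section Monomial

variable {A : Type*} [Ring A] {n : ℕ}

/-- The total degree of an exponent. -/
def totalDeg (α : Fin n → ℕ) : ℕ := ∑ i, α i

theorem totalDeg_add (α β : Fin n → ℕ) : totalDeg (α + β) = totalDeg α + totalDeg β := by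
  simp [totalDeg, Finset.sum_add_distrib]

theorem totalDeg_single (i : Fin n) : totalDeg (Pi.single i 1) = 1 := by
  simp [totalDeg]

/-- Only trivial factors x_k ^ 0 precede the power of x_i, so nothing has to be commuted. -/
theorem mul_prod_map_pow (x : Fin n → A) (i : Fin n) (α : Fin n → ℕ) (hα : ∀ k < i, α k = 0)
    (l : List (Fin n)) (hl : l.Pairwise (· < ·)) (hi : i ∈ l) :
    x i * (l.map fun k => x k ^ α k).prod =
      (l.map fun k => x k ^ (α + Pi.single i 1 : Fin n → ℕ) k).prod := by
  induction l with
  | nil => simp at hi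
  | cons k t ih =>
    obtain ⟨hk, ht⟩ := List.pairwise_cons.1 hl
    simp only [List.map_cons, List.prod_cons]
    by_cases hki : k = i
    · subst hki
      have e : (t.map fun j => x j ^ (α + Pi.single k 1 : Fin n → ℕ) j) = t.map fun j => x j ^ α j :=
        List.map_congr_left fun j hj => by simp [(hk j hj).ne']
      rw [e, ← mul_assoc, ← pow_succ']
      simp
    · have hit : i ∈ t := by simpa [Ne.symm hki] using hi
      rw [hα k (hk i hit), pow_zero, one_mul, ih ht hit]
      simp [hki, hα k (hk i hit)]

theorem mul_monomial_of_le (x : Fin n → A) (i : Fin n) (α : Fin n → ℕ) (hα : ∀ k < i, α k = 0) :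
    x i * monomial x α = monomial x (α + Pi.single i 1) :=
  mul_prod_map_pow x i α hα _ (List.pairwise_lt_finRange n) (List.mem_finRange i)

end Monomial

/-! ### The degree filtration and leading terms -/

namespace IsSkewPBW

variable {A : Type*} [Ring A] {n : ℕ} {R : Subring A} {x : Fin n → A}

/-- The elements of total degree at most `k`. -/
noncomputable def degLE (h : IsSkewPBW R x) (k : ℕ) : Submodule R A where
  carrier := {f | ∀ α, k < totalDeg α → h.basis.repr f α = 0}
  add_mem' hf hg α hα := by simp [hf α hα, hg α hα]
  zero_mem' α _ := by simp
  smul_mem' r f hf α hα := by simp [hf α hα]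

variable (h : IsSkewPBW R x)

theorem degLE_mono {k l : ℕ} (hkl : k ≤ l) : h.degLE k ≤ h.degLE l :=
  fun _ hf α hα => hf α (hkl.trans_lt hα)

theorem repr_monomial (α : Fin n → ℕ) : h.basis.repr (monomial x α) = Finsupp.single α 1 := by
  rw [← h.basis_apply, h.basis.repr_self]

theorem monomial_mem_degLE {α : Fin n → ℕ} {k : ℕ} (hα : totalDeg α ≤ k) :
    monomial x α ∈ h.degLE k := by
  intro β hβ
  rw [repr_monomial, Finsupp.single_eq_of_ne]
  rintro rfl
  omega

theorem eq_sum_monomial (f : A) :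
    f = ∑ γ ∈ (h.basis.repr f).support, h.basis.repr f γ • monomial x γ := by
  conv_lhs => rw [← h.basis.linearCombination_repr f, Finsupp.linearCombination_apply, Finsupp.sum]
  simp [h.basis_apply]

theorem mul_smul_eq (i : Fin n) (r : R) (f : A) :
    x i * (r • f) = h.sigma i r • (x i * f) + h.delta i r • f := by
  simp only [Subring.smul_def, smul_eq_mul]
  rw [← mul_assoc, h.mul_eq i r]
  noncomm_ring

theorem var_mul_eq_sum (i : Fin n) (f : A) :
    x i * f = ∑ γ ∈ (h.basis.repr f).support,
      (h.sigma i (h.basis.repr f γ) • (x i * monomial x γ) +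
        h.delta i (h.basis.repr f γ) • monomial x γ) := by
  conv_lhs => rw [h.eq_sum_monomial f, Finset.mul_sum]
  simp only [h.mul_smul_eq]

theorem var_mul_mem_degLE {k : ℕ} (i : Fin n)
    (hk : ∀ γ : Fin n → ℕ, totalDeg γ ≤ k → x i * monomial x γ ∈ h.degLE (k + 1)) {f : A}
    (hf : f ∈ h.degLE k) : x i * f ∈ h.degLE (k + 1) := by
  rw [h.var_mul_eq_sum i f]
  refine sum_mem fun γ hγ => ?_
  have hγk : totalDeg γ ≤ k := by
    by_contra! hlt
    exact Finsupp.mem_support_iff.1 hγ (hf γ hlt)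
  exact add_mem (Submodule.smul_mem _ _ (hk γ hγk))
    (Submodule.smul_mem _ _ (h.monomial_mem_degLE (by omega)))

/-- For `j < i` the coefficient of `x_j x_i` in `x_i x_j` has a left inverse. -/
theorem exists_comm_of_lt (h : IsSkewPBW R x) {i j : Fin n} (hji : j < i) :
    ∃ d d' r₀ : R, ∃ r : Fin n → R, d' * d = 1 ∧
      x i * x j = d * (x j * x i) + (r₀ + ∑ k, (r k : A) * x k) := by
  have hlin : ∀ (r₀ : R) (r : Fin n → R), (r₀ : A) + ∑ k, (r k : A) * x k ∈ h.degLE 1 := by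
    intro r₀ r
    refine add_mem ?_ (sum_mem fun k _ => ?_)
    · have := Submodule.smul_mem _ r₀ (h.monomial_mem_degLE (α := 0) (k := 1) (by simp [totalDeg]))
      simpa [monomial_zero, Subring.smul_def] using this
    · have := Submodule.smul_mem _ (r k)
        (h.monomial_mem_degLE (α := Pi.single k 1) (k := 1) (totalDeg_single k).le)
      simpa [monomial_single, Subring.smul_def] using this
  obtain ⟨d, -, r₀, r, hd⟩ := h.exists_comm j i
  obtain ⟨d', -, s₀, s, hd'⟩ := h.exists_comm i j
  refine ⟨d, d', r₀, r, ?_, by rw [← hd]; abel⟩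
  let μ : Fin n → ℕ := Pi.single i 1 + Pi.single j 1
  have hμ : x j * x i = monomial x μ := by
    rw [← monomial_single x i]
    refine mul_monomial_of_le x j _ fun k hk => ?_
    simp [(hk.trans hji).ne]
  have hμdeg : totalDeg μ = 2 := by simp [μ, totalDeg_add, totalDeg_single]
  -- Inserting the relation for x_i x_j into that for x_j x_i returns x_j x_i with coefficient d' d,
  -- up to degree one; μ has degree two, so d' d = 1.
  have e : monomial x μ - (d' * d) • monomial x μ =
      d' • ((r₀ : A) + ∑ k, (r k : A) * x k) + (s₀ + ∑ k, (s k : A) * x k) := by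
    rw [← hd, ← hd', ← hμ]
    simp only [Subring.smul_def, smul_eq_mul, Subring.coe_mul]
    noncomm_ring
  have hmem : monomial x μ - (d' * d) • monomial x μ ∈ h.degLE 1 := by
    rw [e]
    exact add_mem (Submodule.smul_mem _ _ (hlin _ _)) (hlin _ _)
  have h0 := hmem μ (by omega)
  simp only [map_sub, map_smul, repr_monomial, Finsupp.coe_sub, Finsupp.coe_smul, Pi.sub_apply,
    Pi.smul_apply, Finsupp.single_eq_same, smul_eq_mul, mul_one] at h0
  exact (sub_eq_zero.1 h0).symm

/-- A completely prime ideal of the coefficient ring that is invariant under all `σ_i`, `δ_i`,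
the preimages under `σ_i` included. -/
structure IsStablePrime (P : TwoSidedIdeal R) : Prop extends IsCompletelyPrime P where
  sigma_mem_iff : ∀ (i : Fin n) (a : R), h.sigma i a ∈ P ↔ a ∈ P
  delta_mem : ∀ (i : Fin n) (a : R), a ∈ P → h.delta i a ∈ P

variable {h} {P : TwoSidedIdeal R}

/-- If x_j is the first variable in the monomial and j < i, then x_i is commuted past x_j and the
induction applies to the shorter monomial. The new leading coefficient d σ_j(u) stays outside P,
since d is left invertible and P is stable and completely prime. -/
theorem IsStablePrime.exists_var_mul_monomial (hP : h.IsStablePrime P) (m : ℕ) :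
    ∀ α : Fin n → ℕ, totalDeg α = m → ∀ i, ∃ u ∉ P,
      x i * monomial x α - u • monomial x (α + Pi.single i 1) ∈ h.degLE m := by
  induction m using Nat.strong_induction_on with
  | _ m ih =>
    intro α hα i
    have hvar : ∀ γ : Fin n → ℕ, totalDeg γ < m → ∀ k, x k * monomial x γ ∈ h.degLE m := by
      intro γ hγ k
      obtain ⟨u, -, hu⟩ := ih _ hγ γ rfl k
      have h1 : u • monomial x (γ + Pi.single k 1) ∈ h.degLE m :=
        Submodule.smul_mem _ _ (h.monomial_mem_degLE (by
          rw [totalDeg_add, totalDeg_single]; omega))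
      simpa using add_mem (h.degLE_mono hγ.le hu) h1
    by_cases hle : ∀ k < i, α k = 0
    · refine ⟨1, hP.one_notMem, ?_⟩
      rw [mul_monomial_of_le x i α hle, one_smul, sub_self]
      exact zero_mem _
    have hex : ∃ j, α j ≠ 0 := by
      push Not at hle
      exact hle.imp fun k hk => hk.2
    obtain ⟨j, hj, hjmin⟩ := WellFounded.has_min (wellFounded_lt (α := Fin n)) {j | α j ≠ 0} hex
    have hjmin' : ∀ k < j, α k = 0 := fun k hk => by
      by_contra h0
      exact hjmin k h0 hk
    have hji : j < i := by
      by_contra! hij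
      exact hle fun k hk => hjmin' k (hk.trans_le hij)
    let β : Fin n → ℕ := α - Pi.single j 1
    have hαβ : α = β + Pi.single j 1 := by
      refine (tsub_add_cancel_of_le fun k => ?_).symm
      by_cases hk : k = j
      · subst hk
        simpa using Nat.one_le_iff_ne_zero.2 hj
      · simp [hk]
    have hβ0 : ∀ k < j, β k = 0 := fun k hk => by simp [β, hjmin' k hk]
    have hβdeg : totalDeg β + 1 = m := by
      rw [← hα, hαβ, totalDeg_add, totalDeg_single]
    obtain ⟨u, hu, hlow⟩ := ih (totalDeg β) (by omega) β rfl i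
    obtain ⟨d, d', r₀, r, hdd, hcomm⟩ := h.exists_comm_of_lt hji
    have hd : d ∉ P := fun hd => hP.one_notMem (hdd ▸ P.mul_mem_left d' d hd)
    refine ⟨d * h.sigma j u, hP.mul_notMem hd fun hσ => hu ((hP.sigma_mem_iff j u).1 hσ), ?_⟩
    have hxα : monomial x α = x j * monomial x β := by
      rw [hαβ, mul_monomial_of_le x j β hβ0]
    have hxαi : monomial x (α + Pi.single i 1) = x j * monomial x (β + Pi.single i 1) := by
      rw [mul_monomial_of_le x j, hαβ]
      · congr 1
        abel
      · intro k hk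
        simp [hβ0 k hk, (hk.trans hji).ne]
    have e : x i * monomial x α - (d * h.sigma j u) • monomial x (α + Pi.single i 1) =
        d • (x j * (x i * monomial x β - u • monomial x (β + Pi.single i 1))) +
          d • h.delta j u • monomial x (β + Pi.single i 1) +
          (r₀ • monomial x β + ∑ k, r k • (x k * monomial x β)) := by
      rw [mul_sub, h.mul_smul_eq, hxα, hxαi, ← mul_assoc (x i), hcomm]
      simp only [Subring.smul_def, smul_eq_mul, Subring.coe_mul, add_mul, Finset.sum_mul]
      noncomm_ring
    rw [e]
    refine add_mem (add_mem ?_ ?_) (add_mem ?_ (sum_mem fun k _ => ?_))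
    · refine Submodule.smul_mem _ _ ?_
      have := h.var_mul_mem_degLE (k := totalDeg β) j
        (fun γ hγ => by rw [hβdeg]; exact hvar γ (by omega) j) hlow
      rwa [hβdeg] at this
    · refine Submodule.smul_mem _ _ (Submodule.smul_mem _ _ (h.monomial_mem_degLE ?_))
      rw [totalDeg_add, totalDeg_single, hβdeg]
    · exact Submodule.smul_mem _ _ (h.monomial_mem_degLE (by omega))
    · exact Submodule.smul_mem _ _ (hvar β (by omega) k)

end IsSkewPBW

end SkewPBW

namespace SkewPBW

/-! ### Leading exponents modulo a stable prime ideal -/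

/-- The exponent as an element of the degree-lexicographic order. -/
def degLexKey {n : ℕ} (α : Fin n → ℕ) : ℕ ×ₗ Lex (Fin n → ℕ) :=
  toLex (totalDeg α, toLex α)

section Key

variable {n : ℕ} {α β : Fin n → ℕ}

theorem degLexKey_add (α β : Fin n → ℕ) : degLexKey (α + β) = degLexKey α + degLexKey β := by
  rw [degLexKey, totalDeg_add]
  rfl

theorem degLexKey_injective : Function.Injective (degLexKey (n := n)) := fun α β h => by
  simpa [degLexKey] using congrArg (fun z => ofLex (ofLex z).2) h

theorem degLexKey_lt_of_totalDeg_lt (h : totalDeg α < totalDeg β) :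
    degLexKey α < degLexKey β :=
  Prod.Lex.toLex_lt_toLex.2 (Or.inl h)

theorem totalDeg_le_of_degLexKey_le (h : degLexKey α ≤ degLexKey β) :
    totalDeg α ≤ totalDeg β := by
  by_contra! hlt
  exact absurd h (degLexKey_lt_of_totalDeg_lt hlt).not_ge

end Key

namespace IsSkewPBW

variable {A : Type*} [Ring A] {n : ℕ} {R : Subring A} {x : Fin n → A} (h : IsSkewPBW R x)

theorem repr_var_mul (i : Fin n) (f : A) (η : Fin n → ℕ) :
    h.basis.repr (x i * f) η = ∑ γ ∈ (h.basis.repr f).support,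
      (h.sigma i (h.basis.repr f γ) * h.basis.repr (x i * monomial x γ) η +
        h.delta i (h.basis.repr f γ) * (Finsupp.single γ 1 : (Fin n → ℕ) →₀ R) η) := by
  rw [h.var_mul_eq_sum i f, map_sum, Finsupp.finsetSum_apply]
  simp only [map_add, map_smul, h.repr_monomial, Finsupp.coe_add, Finsupp.coe_smul,
    Pi.add_apply, Pi.smul_apply, smul_eq_mul]

theorem repr_mul (f g : A) (η : Fin n → ℕ) :
    h.basis.repr (f * g) η = ∑ γ ∈ (h.basis.repr f).support,
      h.basis.repr f γ * h.basis.repr (monomial x γ * g) η := by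
  conv_lhs => rw [h.eq_sum_monomial f, Finset.sum_mul, map_sum, Finsupp.finsetSum_apply]
  simp [smul_mul_assoc]

/-- `β` is the largest exponent at which the coefficient of `f` is not in `P`. -/
def IsLead (P : TwoSidedIdeal R) (f : A) (β : Fin n → ℕ) : Prop :=
  h.basis.repr f β ∉ P ∧ ∀ γ, h.basis.repr f γ ∉ P → degLexKey γ ≤ degLexKey β

variable {h} {P : TwoSidedIdeal R}

theorem exists_isLead {f : A} (hf : ∃ α, h.basis.repr f α ∉ P) : ∃ β, h.IsLead P f β := by
  classical
  obtain ⟨α, hα⟩ := hf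
  have hmem : ∀ γ, h.basis.repr f γ ∉ P → γ ∈ (h.basis.repr f).support := fun γ hγ => by
    rw [Finsupp.mem_support_iff]
    intro h0
    exact hγ (h0 ▸ P.zero_mem)
  obtain ⟨β, hβ, hmax⟩ := Finset.exists_max_image
    ((h.basis.repr f).support.filter fun γ => h.basis.repr f γ ∉ P) degLexKey
    ⟨α, Finset.mem_filter.2 ⟨hmem α hα, hα⟩⟩
  exact ⟨β, (Finset.mem_filter.1 hβ).2, fun γ hγ => hmax γ (Finset.mem_filter.2 ⟨hmem γ hγ, hγ⟩)⟩

theorem IsLead.repr_mem {f : A} {β γ : Fin n → ℕ} (hf : h.IsLead P f β)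
    (hγ : degLexKey β < degLexKey γ) : h.basis.repr f γ ∈ P := by
  by_contra hn
  exact absurd (hf.2 γ hn) hγ.not_ge

/-- Terms of f with coefficient in P contribute only coefficients in P, by stability. Any other term
at γ contributes at γ + e_i or in degree at most that of γ, so only γ = β reaches β + e_i. -/
theorem IsStablePrime.isLead_var_mul (hP : h.IsStablePrime P) {f : A} {β : Fin n → ℕ}
    (hf : h.IsLead P f β) (i : Fin n) : h.IsLead P (x i * f) (β + Pi.single i 1) := by
  classical
  have hcoef := h.repr_var_mul i f
  have hvar : ∀ γ, ∃ u ∉ P, ∀ η, h.basis.repr (x i * monomial x γ) η =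
      u * (Finsupp.single (γ + Pi.single i 1) 1 : (Fin n → ℕ) →₀ R) η ∨
        totalDeg η ≤ totalDeg γ := by
    intro γ
    obtain ⟨u, hu, hlow⟩ := hP.exists_var_mul_monomial _ γ rfl i
    refine ⟨u, hu, fun η => ?_⟩
    by_cases hη : totalDeg η ≤ totalDeg γ
    · exact Or.inr hη
    · have := hlow η (not_le.1 hη)
      simp only [map_sub, map_smul, h.repr_monomial, Finsupp.coe_sub, Finsupp.coe_smul,
        Pi.sub_apply, Pi.smul_apply, smul_eq_mul] at this
      exact Or.inl (sub_eq_zero.1 this)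
  have hdeg : ∀ γ : Fin n → ℕ, totalDeg (γ + Pi.single i 1) = totalDeg γ + 1 := fun γ => by
    rw [totalDeg_add, totalDeg_single]
  constructor
  · rw [hcoef]
    have hβ : β ∈ (h.basis.repr f).support := by
      rw [Finsupp.mem_support_iff]
      intro h0
      exact hf.1 (h0 ▸ P.zero_mem)
    rw [← Finset.add_sum_erase _ _ hβ]
    intro hmem
    have hrest : ∑ γ ∈ (h.basis.repr f).support.erase β,
        (h.sigma i (h.basis.repr f γ) * h.basis.repr (x i * monomial x γ) (β + Pi.single i 1) +
          h.delta i (h.basis.repr f γ) *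
            (Finsupp.single γ 1 : (Fin n → ℕ) →₀ R) (β + Pi.single i 1)) ∈ P := by
      refine sum_mem fun γ hγ => ?_
      by_cases hγP : h.basis.repr f γ ∈ P
      · exact P.add_mem (P.mul_mem_right _ _ ((hP.sigma_mem_iff i _).2 hγP))
          (P.mul_mem_right _ _ (hP.delta_mem i _ hγP))
      · have hγβ := totalDeg_le_of_degLexKey_le (hf.2 γ hγP)
        have h2 : γ ≠ β + Pi.single i 1 := by
          rintro rfl
          rw [hdeg] at hγβ
          omega
        obtain ⟨u, -, hu⟩ := hvar γ
        obtain h1 | h1 := hu (β + Pi.single i 1)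
        · rw [h1, Finsupp.single_eq_of_ne, Finsupp.single_eq_of_ne h2.symm]
          · simp
          · intro he
            exact (Finset.mem_erase.1 hγ).1 (add_right_cancel he).symm
        · rw [hdeg] at h1
          omega
    have hmain := P.sub_mem hmem hrest
    rw [add_sub_cancel_right] at hmain
    obtain ⟨u, hu, hu'⟩ := hvar β
    have h1 := (hu' (β + Pi.single i 1)).resolve_right (by rw [hdeg]; omega)
    rw [h1, Finsupp.single_eq_same, mul_one, Finsupp.single_eq_of_ne (by simp), mul_zero,
      add_zero] at hmain
    exact hP.mul_notMem (fun hσ => hf.1 ((hP.sigma_mem_iff i _).1 hσ)) hu hmain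
  · intro η hη
    by_contra! hlt
    refine hη ?_
    rw [hcoef]
    refine sum_mem fun γ _ => ?_
    by_cases hγP : h.basis.repr f γ ∈ P
    · exact P.add_mem (P.mul_mem_right _ _ ((hP.sigma_mem_iff i _).2 hγP))
        (P.mul_mem_right _ _ (hP.delta_mem i _ hγP))
    · have hγβ := hf.2 γ hγP
      have hγi : degLexKey (γ + Pi.single i 1) < degLexKey η := by
        refine lt_of_le_of_lt ?_ hlt
        rw [degLexKey_add, degLexKey_add]
        gcongr
      have hγη := totalDeg_le_of_degLexKey_le hγi.le
      rw [hdeg] at hγη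
      obtain ⟨u, -, hu⟩ := hvar γ
      have h1 := (hu η).resolve_right (by omega)
      rw [h1, Finsupp.single_eq_of_ne, Finsupp.single_eq_of_ne]
      · simp
      · rintro rfl
        omega
      · rintro rfl
        exact lt_irrefl _ hγi

theorem IsStablePrime.isLead_monomial_mul (hP : h.IsStablePrime P) {f : A} {β : Fin n → ℕ}
    (hf : h.IsLead P f β) (α : Fin n → ℕ) : h.IsLead P (monomial x α * f) (α + β) := by
  have hpow : ∀ (i : Fin n) (k : ℕ) (f : A) (β : Fin n → ℕ), h.IsLead P f β →
      h.IsLead P (x i ^ k * f) (Pi.single i k + β) := by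
    intro i k
    induction k with
    | zero => intro f β hf; simpa using hf
    | succ k ih =>
      intro f β hf
      have := hP.isLead_var_mul (ih f β hf) i
      rw [← mul_assoc, ← pow_succ'] at this
      rwa [Pi.single_add, add_right_comm]
  have hl : ∀ l : List (Fin n), h.IsLead P ((l.map fun i => x i ^ α i).prod * f)
      ((l.map fun i => (Pi.single i (α i) : Fin n → ℕ)).sum + β) := by
    intro l
    induction l with
    | nil => simpa using hf
    | cons i l ih =>
      simpa only [List.map_cons, List.prod_cons, List.sum_cons, mul_assoc, add_assoc]
        using hpow i (α i) _ _ ih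
  have hsum : ((List.finRange n).map fun i => (Pi.single i (α i) : Fin n → ℕ)).sum = α := by
    rw [← List.ofFn_eq_map, List.sum_ofFn, Finset.univ_sum_single]
  have := hl (List.finRange n)
  rwa [hsum] at this

/-- A product of elements that both have a coefficient outside `P` has such a coefficient. -/
theorem IsStablePrime.exists_repr_mul_notMem (hP : h.IsStablePrime P) {f g : A}
    (hf : ∃ α, h.basis.repr f α ∉ P) (hg : ∃ α, h.basis.repr g α ∉ P) :
    ∃ α, h.basis.repr (f * g) α ∉ P := by
  classical
  obtain ⟨α, hα⟩ := exists_isLead hf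
  obtain ⟨β, hβ⟩ := exists_isLead hg
  refine ⟨α + β, ?_⟩
  have hαs : α ∈ (h.basis.repr f).support := by
    rw [Finsupp.mem_support_iff]
    intro h0
    exact hα.1 (h0 ▸ P.zero_mem)
  rw [h.repr_mul, ← Finset.add_sum_erase _ _ hαs]
  intro hmem
  have hrest : ∑ γ ∈ (h.basis.repr f).support.erase α,
      h.basis.repr f γ * h.basis.repr (monomial x γ * g) (α + β) ∈ P := by
    refine sum_mem fun γ hγ => ?_
    by_cases hγP : h.basis.repr f γ ∈ P
    · exact P.mul_mem_right _ _ hγP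
    · refine P.mul_mem_left _ _ ((hP.isLead_monomial_mul hβ γ).repr_mem ?_)
      have : degLexKey γ < degLexKey α := lt_of_le_of_ne (hα.2 γ hγP)
        fun he => (Finset.mem_erase.1 hγ).1 (degLexKey_injective he)
      rw [degLexKey_add, degLexKey_add]
      gcongr
  have hmain := P.sub_mem hmem hrest
  rw [add_sub_cancel_right] at hmain
  exact hP.mul_notMem hα.1 (hP.isLead_monomial_mul hβ α).1 hmain

/-! ### Extension of a stable prime ideal to `A` -/

theorem IsStablePrime.repr_monomial_mul_mem (hP : h.IsStablePrime P) {f : A}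
    (hf : ∀ η, h.basis.repr f η ∈ P) (α η : Fin n → ℕ) :
    h.basis.repr (monomial x α * f) η ∈ P := by
  let T : Set A := {f | ∀ η, h.basis.repr f η ∈ P}
  have hvar : ∀ i, ∀ g ∈ T, x i * g ∈ T := by
    intro i g hg η
    rw [h.repr_var_mul i g]
    exact sum_mem fun γ _ => P.add_mem (P.mul_mem_right _ _ ((hP.sigma_mem_iff i _).2 (hg γ)))
      (P.mul_mem_right _ _ (hP.delta_mem i _ (hg γ)))
  have hpow : ∀ (i : Fin n) (k : ℕ), ∀ g ∈ T, x i ^ k * g ∈ T := by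
    intro i k g hg
    induction k with
    | zero => simpa using hg
    | succ k ih => simpa only [pow_succ', mul_assoc] using hvar i _ ih
  have hl : ∀ l : List (Fin n), (l.map fun i => x i ^ α i).prod * f ∈ T := by
    intro l
    induction l with
    | nil => simpa using! hf
    | cons i l ih =>
      simpa only [List.map_cons, List.prod_cons, mul_assoc] using hpow i (α i) _ ih
  exact hl (List.finRange n) η

/-- The ideal of the elements whose coefficients all lie in the stable prime ideal `P`. -/
noncomputable def IsStablePrime.extend (hP : h.IsStablePrime P) : TwoSidedIdeal A :=
  TwoSidedIdeal.mk' {f | ∀ α, h.basis.repr f α ∈ P}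
    (fun α => by simp)
    (fun {f g} hf hg α => by simpa using P.add_mem (hf α) (hg α))
    (fun {f} hf α => by simpa using P.neg_mem (hf α))
    (fun {f g} hg α => by
      rw [h.repr_mul]
      exact sum_mem fun γ _ => P.mul_mem_left _ _ (hP.repr_monomial_mul_mem hg γ α))
    (fun {f g} hf α => by
      rw [h.repr_mul]
      exact sum_mem fun γ _ => P.mul_mem_right _ _ (hf γ))

theorem IsStablePrime.mem_extend (hP : h.IsStablePrime P) {f : A} :
    f ∈ hP.extend ↔ ∀ α, h.basis.repr f α ∈ P := by
  simp [extend, TwoSidedIdeal.mem_mk']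

theorem repr_coe_mul_monomial (r : R) (α : Fin n → ℕ) :
    h.basis.repr (r * monomial x α) = Finsupp.single α r := by
  have : (r : A) * monomial x α = r • monomial x α := rfl
  rw [this, map_smul, h.repr_monomial, Finsupp.smul_single, smul_eq_mul, mul_one]

theorem IsStablePrime.coe_mul_monomial_mem_extend_iff (hP : h.IsStablePrime P) {r : R}
    (α : Fin n → ℕ) : (r : A) * monomial x α ∈ hP.extend ↔ r ∈ P := by
  classical
  rw [hP.mem_extend]
  simp only [repr_coe_mul_monomial, Finsupp.single_apply]
  refine ⟨fun hr => by simpa using hr α, fun hr β => ?_⟩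
  split_ifs
  exacts [hr, P.zero_mem]

theorem IsStablePrime.coe_mem_extend_iff (hP : h.IsStablePrime P) {r : R} :
    (r : A) ∈ hP.extend ↔ r ∈ P := by
  simpa [monomial_zero] using hP.coe_mul_monomial_mem_extend_iff (r := r) 0

theorem IsStablePrime.isCompletelyPrime_extend (hP : h.IsStablePrime P) :
    IsCompletelyPrime hP.extend where
  one_notMem h1 := hP.one_notMem (hP.coe_mem_extend_iff.1 (by simpa using h1))
  mem_or_mem f g hfg := by
    by_contra! hn
    simp only [hP.mem_extend, not_forall] at hn
    obtain ⟨α, hα⟩ := hP.exists_repr_mul_notMem hn.1 hn.2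
    exact hα (hP.mem_extend.1 hfg α)

end IsSkewPBW

end SkewPBW

namespace SkewPBW

/-! ### Two minimal prime ideals -/

/-- The elements common to all minimal prime ideals are nilpotent. -/
theorem isNilpotent_of_forall_minimal {S : Type*} [Ring S] {a : S}
    (ha : ∀ P ∈ minimalPrimeIdeals S, a ∈ P) : IsNilpotent a :=
  isNilpotent_of_forall_mem_prime fun P hP => by
    obtain ⟨Q, hQ, hQP⟩ := exists_minimalPrimeIdeal_le hP
    exact hQP (ha Q hQ)

/-- Of two distinct minimal prime ideals, the first has an element outside the second. -/
theorem exists_mem_notMem_of_minimal {S : Type*} [Ring S] {P Q : TwoSidedIdeal S}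
    (hP : P ∈ minimalPrimeIdeals S) (hQ : Q ∈ minimalPrimeIdeals S) (hne : P ≠ Q) :
    ∃ a ∈ P, a ∉ Q := by
  by_contra! hle
  exact hne (le_antisymm hle (hQ.2 hP.1 hle))

/-- Membership of a in P amounts to nilpotency of all b a with b ∈ Q, and nilpotency survives
substitutions. Since σ_i can also be removed, its preimages are covered. -/
theorem IsSkewPBW.isStablePrime_of_minimal {A : Type*} [Ring A] {n : ℕ} {R : Subring A}
    {x : Fin n → A} (h : IsSkewPBW R x) (hc : IsCompatible h.sigma h.delta)
    (htp : IsTwoPrimal R) {P Q : TwoSidedIdeal R} (hP : P ∈ minimalPrimeIdeals R)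
    (hQ : Q ∈ minimalPrimeIdeals R) (hne : P ≠ Q)
    (hPQ : ∀ a, a ∈ P → a ∈ Q → IsNilpotent a) : h.IsStablePrime P := by
  have hPc := isCompletelyPrime_of_minimal htp hP
  obtain ⟨q, hqQ, hqP⟩ := exists_mem_notMem_of_minimal hQ hP hne.symm
  have hmem : ∀ a, a ∈ P ↔ ∀ b ∈ Q, IsNilpotent (b * a) := fun a =>
    ⟨fun ha b hb => hPQ _ (P.mul_mem_left _ _ ha) (Q.mul_mem_right _ _ hb),
      fun ha => (hPc.mem_or_mem q a (hPc.mem_of_isNilpotent (ha q hqQ))).resolve_left hqP⟩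
  refine ⟨hPc, fun i a => ?_, fun i a ha => ?_⟩
  · rw [hmem, hmem]
    exact forall₂_congr fun b _ =>
      ⟨h.isNilpotent_of_subst hc (Subst.sigma_mul b a i),
        h.isNilpotent_of_subst hc (Subst.mul_sigma b a i)⟩
  · rw [hmem] at ha ⊢
    exact fun b hb => h.isNilpotent_of_subst hc (Subst.mul_delta b a i) (ha b hb)

/-! ### The diameter of the nilpotent graph -/

section Diameter

variable {S : Type*} [Ring S]

/-- The element b may coincide with a or c, so each half is bounded by 1 rather than given as an
edge. -/
theorem edist_nilpotentGraph_le_two {a c : {a : S // a ∈ nilZeroDivisors S ∧ a ≠ 0}} {b : S}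
    (hb : b ≠ 0) (hab : IsNilpotent (a.1 * b)) (hbc : IsNilpotent (b * c.1)) :
    (nilpotentGraph S).edist a c ≤ 2 := by
  let v : {a : S // a ∈ nilZeroDivisors S ∧ a ≠ 0} := ⟨b, ⟨c.1, c.2.2, hbc⟩, hb⟩
  have hle : ∀ p q : {a : S // a ∈ nilZeroDivisors S ∧ a ≠ 0}, IsNilpotent (p.1 * q.1) →
      (nilpotentGraph S).edist p q ≤ 1 := by
    intro p q hpq
    by_cases he : p = q
    · subst he
      simp
    · have hadj : (nilpotentGraph S).Adj p q := ⟨he, hpq⟩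
      exact (SimpleGraph.edist_eq_one_iff_adj.2 hadj).le
  calc (nilpotentGraph S).edist a c
      ≤ (nilpotentGraph S).edist a v + (nilpotentGraph S).edist v c :=
        SimpleGraph.edist_triangle
    _ ≤ 1 + 1 := add_le_add (hle a v hab) (hle v c hbc)
    _ = 2 := one_add_one_eq_two

/-- If the nilpotent elements of `S` form the intersection of two completely prime ideals, none
inside the other, then the nilpotent graph of `S` has diameter at most two. -/
theorem ediam_nilpotentGraph_le_two {P Q : TwoSidedIdeal S} (hP : IsCompletelyPrime P)
    (hQ : IsCompletelyPrime Q) (hPQ : ∀ a, a ∈ P → a ∈ Q → IsNilpotent a)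
    (hnP : ∃ p ∈ P, p ∉ Q) (hnQ : ∃ q ∈ Q, q ∉ P) :
    (nilpotentGraph S).ediam ≤ 2 := by
  have hne : ∀ {I : TwoSidedIdeal S} {s : S}, s ∉ I → s ≠ 0 := by
    rintro I s hs rfl
    exact hs I.zero_mem
  obtain ⟨p, hpP, hpQ⟩ := hnP
  obtain ⟨q, hqQ, hqP⟩ := hnQ
  refine SimpleGraph.ediam_le_of_edist_le fun a c => ?_
  by_cases hN : ∃ b : S, b ≠ 0 ∧ b ∈ P ∧ b ∈ Q
  · obtain ⟨b, hb, hbP, hbQ⟩ := hN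
    exact edist_nilpotentGraph_le_two hb
      (hPQ _ (P.mul_mem_left _ _ hbP) (Q.mul_mem_left _ _ hbQ))
      (hPQ _ (P.mul_mem_right _ _ hbP) (Q.mul_mem_right _ _ hbQ))
  push Not at hN
  -- With P ∩ Q = 0, a vertex outside both ideals would force its witness b into P ∩ Q.
  have hvert : ∀ v : {a : S // a ∈ nilZeroDivisors S ∧ a ≠ 0}, v.1 ∈ P ∨ v.1 ∈ Q := by
    rintro ⟨v, ⟨b, hb, hvb⟩, -⟩
    by_contra! hv
    exact hN b hb ((hP.mem_or_mem v b (hP.mem_of_isNilpotent hvb)).resolve_left hv.1)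
      ((hQ.mem_or_mem v b (hQ.mem_of_isNilpotent hvb)).resolve_left hv.2)
  have hadj : ∀ s t, s ∈ P → t ∈ Q → IsNilpotent (s * t) := fun s t hs ht =>
    hPQ _ (P.mul_mem_right _ _ hs) (Q.mul_mem_left _ _ ht)
  have hone : ∀ s t : {a : S // a ∈ nilZeroDivisors S ∧ a ≠ 0}, s.1 ∈ P → t.1 ∈ Q →
      (nilpotentGraph S).edist s t ≤ 2 := by
    intro s t hs ht
    have hst : (nilpotentGraph S).Adj s t := by
      refine ⟨?_, hadj _ _ hs ht⟩
      rintro rfl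
      exact hN _ s.2.2 hs ht
    rw [SimpleGraph.edist_eq_one_iff_adj.2 hst]
    exact one_le_two
  obtain ha | ha := hvert a <;> obtain hc | hc := hvert c
  · exact edist_nilpotentGraph_le_two (hne hqP) (hadj _ _ ha hqQ)
      (isNilpotent_mul_swap (hadj _ _ hc hqQ))
  · exact hone a c ha hc
  · rw [SimpleGraph.edist_comm]
    exact hone c a hc ha
  · exact edist_nilpotentGraph_le_two (hne hpQ) (isNilpotent_mul_swap (hadj _ _ hpP ha))
      (hadj _ _ hpP hc)

theorem two_le_ediam_nilpotentGraph {a b c : S} (hab : a ≠ b) (hn : ¬ IsNilpotent (a * b))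
    (hc : c ≠ 0) (hac : IsNilpotent (a * c)) (hbc : IsNilpotent (b * c)) :
    2 ≤ (nilpotentGraph S).ediam := by
  have ha : a ≠ 0 := by
    rintro rfl
    exact hn (by simp)
  have hb : b ≠ 0 := by
    rintro rfl
    exact hn (by simp)
  let u : {a : S // a ∈ nilZeroDivisors S ∧ a ≠ 0} := ⟨a, ⟨c, hc, hac⟩, ha⟩
  let v : {a : S // a ∈ nilZeroDivisors S ∧ a ≠ 0} := ⟨b, ⟨c, hc, hbc⟩, hb⟩
  refine le_trans ?_ (SimpleGraph.edist_le_ediam (u := u) (v := v))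
  have h0 : (nilpotentGraph S).edist u v ≠ 0 := fun h0 =>
    hab (congrArg Subtype.val (SimpleGraph.edist_eq_zero_iff.1 h0))
  have h1 : (nilpotentGraph S).edist u v ≠ 1 := fun h1 =>
    hn (SimpleGraph.edist_eq_one_iff_adj.1 h1).2
  have h2 : 1 < (nilpotentGraph S).edist u v :=
    lt_of_le_of_ne (Order.one_le_iff_pos.2 (pos_iff_ne_zero.2 h0)) h1.symm
  simpa [one_add_one_eq_two] using Order.add_one_le_of_lt h2

end Diameter

end SkewPBW

theorem mainTheorem1 {A : Type*} [Ring A] (R : Subring A) {n : ℕ} (hn : 0 < n)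
    (x : Fin n → A) (hA : SkewPBW.IsSkewPBW R x)
    (hcompat : SkewPBW.IsCompatible hA.sigma hA.delta)
    (hprimal : SkewPBW.IsTwoPrimal R)
    (hmin : (SkewPBW.minimalPrimeIdeals R).encard = 2) :
    (SkewPBW.nilpotentGraph A).ediam = 2 := by
  obtain ⟨P, Q, hne, hset⟩ := Set.encard_eq_two.1 hmin
  have hPmin : P ∈ SkewPBW.minimalPrimeIdeals R := by simp [hset]
  have hQmin : Q ∈ SkewPBW.minimalPrimeIdeals R := by simp [hset]
  have hPQ : ∀ a, a ∈ P → a ∈ Q → IsNilpotent a := fun a haP haQ =>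
    SkewPBW.isNilpotent_of_forall_minimal fun I hI => by
      rw [hset] at hI
      obtain rfl | rfl := hI
      exacts [haP, haQ]
  have hP := hA.isStablePrime_of_minimal hcompat hprimal hPmin hQmin hne hPQ
  have hQ := hA.isStablePrime_of_minimal hcompat hprimal hQmin hPmin hne.symm
    fun a haQ haP => hPQ a haP haQ
  have hnil : ∀ f : A, f ∈ hP.extend → f ∈ hQ.extend → IsNilpotent f := fun f hfP hfQ =>
    hA.isNilpotent_of_coeff hcompat hprimal fun α =>
      hPQ _ (hP.mem_extend.1 hfP α) (hQ.mem_extend.1 hfQ α)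
  obtain ⟨p, hpP, hpQ⟩ := SkewPBW.exists_mem_notMem_of_minimal hPmin hQmin hne
  obtain ⟨q, hqQ, hqP⟩ := SkewPBW.exists_mem_notMem_of_minimal hQmin hPmin hne.symm
  have hpP' := hP.coe_mem_extend_iff.2 hpP
  have hpQ' := mt hQ.coe_mem_extend_iff.1 hpQ
  have hqQ' := hQ.coe_mem_extend_iff.2 hqQ
  have hqP' := mt hP.coe_mem_extend_iff.1 hqP
  refine le_antisymm (SkewPBW.ediam_nilpotentGraph_le_two hP.isCompletelyPrime_extend
    hQ.isCompletelyPrime_extend hnil ⟨p, hpP', hpQ'⟩ ⟨q, hqQ', hqP'⟩) ?_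
  -- A variable supplies a second element p x_1, distinct from p and also in the extension of P but
  -- not of Q; q makes both of them vertices.
  let i : Fin n := ⟨0, hn⟩
  let α : Fin n → ℕ := Pi.single i 1
  have hα : α ≠ 0 := by simp [α]
  have hpx : (p : A) * SkewPBW.monomial x α ∉ hQ.extend :=
    mt (hQ.coe_mul_monomial_mem_extend_iff α).1 hpQ
  have hnilq : ∀ f : A, f ∈ hP.extend → IsNilpotent (f * q) := fun f hf =>
    hnil _ (hP.extend.mul_mem_right _ _ hf) (hQ.extend.mul_mem_left _ _ hqQ')
  refine SkewPBW.two_le_ediam_nilpotentGraph (a := (p : A)) (b := p * SkewPBW.monomial x α)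
    (c := (q : A)) (fun he => hpQ ?_) (fun hnp => ?_) ?_ (hnilq _ hpP')
    (hnilq _ (hP.extend.mul_mem_right _ _ hpP'))
  -- Equality of p and p x_1 would give p = 0 on comparing constant coefficients.
  · have h1 : (p : A) * SkewPBW.monomial x 0 = p * SkewPBW.monomial x α := by
      rw [SkewPBW.monomial_zero, mul_one]
      exact he
    have h2 := congrArg (fun f => hA.basis.repr f 0) h1
    simp only [hA.repr_coe_mul_monomial, Finsupp.single_eq_same] at h2
    rw [h2, Finsupp.single_eq_of_ne hα.symm]
    exact Q.zero_mem
  · exact hQ.isCompletelyPrime_extend.mul_notMem hpQ' hpx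
      (hQ.isCompletelyPrime_extend.mem_of_isNilpotent hnp)
  · intro hq0
    exact hqP' (hq0 ▸ hP.extend.zero_mem)
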